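/- Let $(F,g_F)$ be a connected Riemannian manifold of dimension $n-1\ge 2$, let $I\subseteq\mathbb{R}$ be an open interval and let $f:I\to(0,\infty)$ be smooth. Let $\overline M=I\times_f F$ be the associated GRW spacetime, i.e. the manifold $I\times F$ with the Lorentzian metric $\overline g=-\pi_I^*(dt^2)+f(\pi_I)^2\,\pi_F^*(g_F)$, and let $\partial_t=\partial/\partial t$. Let $M^k$ be a connected smooth manifold and $\psi:M\to\overline M$ a smooth spacelike immersion, i.e. the induced metric $g=\psi^*\overline g$ is Riemannian. Put $\tau=\pi_I\circ\psi$. Let $\mathrm{II}(X,Y)=-(\overline\nabla_XY)^\perp$ be the second fundamental form of $\psi$ (note the sign), where $\overline\nabla$ is the Levi-Civita connection of $\overline g$ and $\perp$ denotes the normal component, and let $\overrightarrow{H}=\frac1k\,\mathrm{trace}_g(\mathrm{II})$ be the mean curvature vector field. Assume that $(M,g)$ is parabolic, i.e. every smooth function $u$ on $M$ that is bounded from below and superharmonic ($\Delta u\le 0$ for the Laplacian $\Delta$ of $g$) is constant, and that $\psi(M)$ is contained in a slab, i.e. there are $c,d\in I$ with $c\le\tau\le d$ on $M$. If $$\overline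 g(\overrightarrow H,\partial_t)\le\frac{f'(\tau)}{f(\tau)}\ \text{ everywhere on } M,\qquad\text{or}\qquad \overline g(\overrightarrow H,\partial_t)\ge\frac{f'(\tau)}{f(\tau)}\ \text{ everywhere on } M,$$ then $\psi(M)$ is contained in a spacelike slice $\{t_0\}\times F$ for some $t_0\in I$. -/

import Mathlib

open Set Bundle
open scoped Manifold ContDiff

noncomputable section

namespace GRW

/-! ### Metric tensors, Levi-Civita connection, Hessian and Laplacian

Mathlib identifies the tangent space `TangentSpace J x` with the model space `E` through the
preferred chart at `x`. -/

/-- The pull-back `(v, w) ↦ b(A v, A w)` of a bilinear form `b`. -/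
def pullback {E E' : Type*} [NormedAddCommGroup E] [NormedSpace ℝ E] [NormedAddCommGroup E']
    [NormedSpace ℝ E'] (A : E →L[ℝ] E') (b : E' →L[ℝ] E' →L[ℝ] ℝ) : E →L[ℝ] E →L[ℝ] ℝ :=
  b.bilinearComp A A

section General

variable {E H N : Type*} [NormedAddCommGroup E] [NormedSpace ℝ E] [TopologicalSpace H]
  (J : ModelWithCorners ℝ E H) [TopologicalSpace N] [ChartedSpace H N]

/-- A field of bilinear forms on the tangent spaces of `N`. -/
abbrev MetricTensor : Type _ :=
  ∀ x : N, TangentSpace J x →L[ℝ] TangentSpace J x →L[ℝ] ℝ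

variable {J}

/-- The bilinear form `g x` on the tangent space at `x`, read on the model space. -/
def formAt (g : MetricTensor J (N := N)) (x : N) : E →L[ℝ] E →L[ℝ] ℝ := g x

/-- The components of the metric tensor `g` in the chart at `x₀`:
`G(y)(v, w) = g(Dφ⁻¹(y) v, Dφ⁻¹(y) w)`, where `φ` is the chart at `x₀`. -/
def coordMetric (g : MetricTensor J (N := N)) (x₀ : N) (y : E) : E →L[ℝ] E →L[ℝ] ℝ :=
  pullback (E := E) (E' := E) (mfderivWithin 𝓘(ℝ, E) J (extChartAt J x₀).symm (range J) y)
    (formAt g ((extChartAt J x₀).symm y))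

/-- The vector `♯α` with `b(♯α, ·) = α`, for a nondegenerate bilinear form `b` on a
finite-dimensional space (`b` is read as the linear map `v ↦ b(v, ·)`, and inverted). -/
def sharp (b : E →L[ℝ] E →L[ℝ] ℝ) (α : E →L[ℝ] ℝ) : E :=
  ContinuousLinearMap.inverse b α

/-- Christoffel symbols of the metric with components `G`: `Γ(u, v)` is the vector with
`G(Γ(u, v), w) = ½ (∂_u G(v, w) + ∂_v G(u, w) - ∂_w G(u, v))` for all `w`. -/
def christoffel (G : E → E →L[ℝ] E →L[ℝ] ℝ) (y : E) (u v : E) : E :=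
  sharp (G y) ((1 / 2 : ℝ) •
    (fderiv ℝ G y u v + fderiv ℝ G y v u - ((fderiv ℝ G y).flip u).flip v))

/-- Christoffel symbols, at the point `x` and in the chart at `x`, of the Levi-Civita connection
of `g`. -/
def christoffelAt (g : MetricTensor J (N := N)) (x : N) (u v : E) : E :=
  christoffel (coordMetric g x) (extChartAt J x x) u v

end General

section Submanifold

variable {k : ℕ} {M : Type*} [TopologicalSpace M] [ChartedSpace (EuclideanSpace ℝ (Fin k)) M]

/-- The trace with respect to `b` of a bilinear map `S`: `∑ b^{ij} S(e_i, e_j)`. When `b` is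
positive definite this is `∑ S(E_i, E_i)` for any `b`-orthonormal basis `(E_i)`. -/
def metricTrace {W : Type*} [AddCommGroup W]
    (b : EuclideanSpace ℝ (Fin k) →L[ℝ] EuclideanSpace ℝ (Fin k) →L[ℝ] ℝ)
    (S : EuclideanSpace ℝ (Fin k) → EuclideanSpace ℝ (Fin k) → W) : W :=
  ∑ i, S (EuclideanSpace.single i 1) (sharp b (EuclideanSpace.proj i))

/-- The Hessian `Hess u (v, w) = ∂_v ∂_w u - du(Γ(v, w))` at `p`, in the chart at `p`. -/
def hessian (g : MetricTensor (𝓡 k) (N := M)) (u : M → ℝ) (p : M)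
    (v w : EuclideanSpace ℝ (Fin k)) : ℝ :=
  fderiv ℝ (fderiv ℝ (u ∘ (extChartAt (𝓡 k) p).symm)) (extChartAt (𝓡 k) p p) v w
    - fderiv ℝ (u ∘ (extChartAt (𝓡 k) p).symm) (extChartAt (𝓡 k) p p) (christoffelAt g p v w)

/-- The Laplace-Beltrami operator `Δ u = trace_g (Hess u)`. -/
def laplacian (g : MetricTensor (𝓡 k) (N := M)) (u : M → ℝ) (p : M) : ℝ :=
  metricTrace (formAt g p) (hessian g u p)

/-- `(M, g)` is parabolic: the only (smooth) superharmonic functions on `M` that are bounded from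
below are the constants. -/
def IsParabolic (g : MetricTensor (𝓡 k) (N := M)) : Prop :=
  ∀ u : M → ℝ, ContMDiff (𝓡 k) 𝓘(ℝ, ℝ) ∞ u → (∀ p, laplacian g u p ≤ 0) →
    BddBelow (range u) → ∃ c : ℝ, ∀ p, u p = c

variable {E H N : Type*} [NormedAddCommGroup E] [NormedSpace ℝ E] [TopologicalSpace H]
  {J : ModelWithCorners ℝ E H} [TopologicalSpace N] [ChartedSpace H N]

variable (k)

/-- The differential of `ψ` at `p`, read on the model spaces. -/
def diff (J : ModelWithCorners ℝ E H) (ψ : M → N) (p : M) : EuclideanSpace ℝ (Fin k) →L[ℝ] E :=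
  mfderiv (𝓡 k) J ψ p

/-- The metric `ψ^* g` induced on `M` by `ψ : M → (N, g)`. -/
def inducedMetric (g : MetricTensor J (N := N)) (ψ : M → N) : MetricTensor (𝓡 k) (N := M) :=
  fun p => pullback (diff k J ψ p) (formAt g (ψ p))

/-- `ψ` is spacelike: the induced metric is positive definite. In particular `dψ` is injective. -/
def IsSpacelike (g : MetricTensor J (N := N)) (ψ : M → N) : Prop :=
  ∀ (p : M) (v : TangentSpace (𝓡 k) p), v ≠ 0 →
    0 < g (ψ p) (mfderiv (𝓡 k) J ψ p v) (mfderiv (𝓡 k) J ψ p v)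

/-- `∇̄_u V` at `p`, for the Levi-Civita connection `∇̄` of `g`, where `V` is the tangent field
`dψ(v)` and `v` is extended to a vector field near `p` with constant components in the chart at
`p`. In the charts at `p` and `ψ p` it is `∂_u ∂_v ψ + Γ̄(∂_u ψ, ∂_v ψ)`. -/
def ambientDeriv (g : MetricTensor J (N := N)) (ψ : M → N) (p : M)
    (u v : EuclideanSpace ℝ (Fin k)) : E :=
  fderiv ℝ (fderiv ℝ (writtenInExtChartAt (𝓡 k) J p ψ)) (extChartAt (𝓡 k) p p) u v
    + christoffelAt g (ψ p) (diff k J ψ p u) (diff k J ψ p v)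

/-- The component of `w` tangent to `ψ` at `p`: it is `dψ(a)`, where `a` is determined by
`(ψ^* g)(a, ·) = g(w, dψ(·))`. -/
def tangentPart (g : MetricTensor J (N := N)) (ψ : M → N) (p : M) (w : E) : E :=
  diff k J ψ p (sharp (formAt (inducedMetric k g ψ) p) ((formAt g (ψ p) w).comp (diff k J ψ p)))

/-- The component of `w` normal to `ψ` at `p`. -/
def normalPart (g : MetricTensor J (N := N)) (ψ : M → N) (p : M) (w : E) : E :=
  w - tangentPart k g ψ p w

/-- The second fundamental form, with the sign convention `II(u, v) = -(∇̄_u v)^⊥`. -/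
def secondFundamentalForm (g : MetricTensor J (N := N)) (ψ : M → N) (p : M)
    (u v : EuclideanSpace ℝ (Fin k)) : E :=
  -normalPart k g ψ p (ambientDeriv k g ψ p u v)

/-- The mean curvature vector `H = (1 / k) trace(II)`. -/
def meanCurvature (g : MetricTensor J (N := N)) (ψ : M → N) (p : M) : TangentSpace J (ψ p) :=
  ((1 / k : ℝ) •
    metricTrace (formAt (inducedMetric k g ψ) p) (secondFundamentalForm k g ψ p) : E)

end Submanifold

/-! ### Generalized Robertson-Walker spacetimes

For an open interval `I`, the manifold `I × F` is handled as the open subset `I ×ˢ univ` of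
`ℝ × F`. -/

section Spacetime

variable {m : ℕ} {F : Type*} [TopologicalSpace F] [ChartedSpace (EuclideanSpace ℝ (Fin m)) F]
  [IsManifold (𝓡 m) ∞ F]

/-- Smooth Riemannian metrics on `F`. -/
abbrev RiemMetric (m : ℕ) (F : Type*) [TopologicalSpace F]
    [ChartedSpace (EuclideanSpace ℝ (Fin m)) F] [IsManifold (𝓡 m) ∞ F] : Type _ :=
  ContMDiffRiemannianMetric (𝓡 m) ∞ (EuclideanSpace ℝ (Fin m))
    (fun x : F => TangentSpace (𝓡 m) x)

/-- The Lorentzian metric `-π_I^* dt² + f(π_I)² π_F^* g_F`. -/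
def warpedMetric (f : ℝ → ℝ) (gF : RiemMetric m F) :
    MetricTensor (𝓘(ℝ, ℝ).prod (𝓡 m)) (N := ℝ × F) := fun q =>
  -pullback (E := ℝ × EuclideanSpace ℝ (Fin m)) (E' := ℝ)
      (mfderiv (𝓘(ℝ, ℝ).prod (𝓡 m)) 𝓘(ℝ, ℝ) Prod.fst q) (ContinuousLinearMap.mul ℝ ℝ)
    + (f q.1 ^ 2) • pullback (E := ℝ × EuclideanSpace ℝ (Fin m)) (E' := EuclideanSpace ℝ (Fin m))
      (mfderiv (𝓘(ℝ, ℝ).prod (𝓡 m)) (𝓡 m) Prod.snd q) (gF.inner q.2)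

/-- The vector field `∂_t`. -/
def partialT (q : ℝ × F) : TangentSpace (𝓘(ℝ, ℝ).prod (𝓡 m)) q :=
  ((1 : ℝ), (0 : EuclideanSpace ℝ (Fin m)))

/-- The spacelike slice `{t₀} × F`. -/
def slice (F : Type*) (t₀ : ℝ) : Set (ℝ × F) := {t₀} ×ˢ univ

/-- `S` lies in a slab of `I × F`, i.e. between two spacelike slices `{c} × F` and `{d} × F` with
`c, d ∈ I`. -/
def InSlab (I : Set ℝ) (S : Set (ℝ × F)) : Prop :=
  ∃ c ∈ I, ∃ d ∈ I, S ⊆ Icc c d ×ˢ univ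

end Spacetime

end GRW

end

set_option synthInstance.maxHeartbeats 400000
set_option maxHeartbeats 1000000


/-! Let `Φ` be a primitive of `f` and `u = Φ(τ)`. On the spacetime the gradient of `Φ(t)` is `-f
∂_t`, and `f ∂_t` is a closed conformal field, `∇̄_X (f ∂_t) = f' X`. Restricting the ambient
Hessian to the submanifold therefore gives `Hess u = f ḡ(II, ∂_t) - f' g`, with the sign convention
of `II`, and tracing gives `Δu = k f (ḡ(H, ∂_t) - f'/f)`. Each curvature bound thus makes `u` or
`-u` superharmonic, while the slab bounds both from below. Parabolicity makes `u` constant, and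
since `Φ' = f > 0`, so is `τ`. Everything is computed in the charts at `p` and `ψ p`. Two facts
carry the Hessian formula (`hessian_comp_time`): the Gauss formula (`tangentPart_ambientDeriv`, from
`koszul_pullback`) and the time component of the warped Christoffel symbols
(`christoffelAt_warpedMetric_fst`), which encodes the conformal property of `f ∂_t`. -/

namespace GRW

open Filter Topology

/-! ### Nondegenerate forms and the Koszul formula under pull-back -/

section Linear

variable {E E' : Type*} [NormedAddCommGroup E] [NormedSpace ℝ E] [NormedAddCommGroup E']
  [NormedSpace ℝ E']

@[simp]
lemma pullback_apply (A : E →L[ℝ] E') (b : E' →L[ℝ] E' →L[ℝ] ℝ) (v w : E) :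
    pullback A b v w = b (A v) (A w) := rfl

/-- An injective map from `E` to its dual is bijective by dimension. Invertibility matters because
`sharp` uses `ContinuousLinearMap.inverse`, which is zero on non-invertible maps. -/
lemma isInvertible_of_separatingLeft [FiniteDimensional ℝ E] (b : E →L[ℝ] E →L[ℝ] ℝ)
    (hb : ∀ v, (∀ w, b v w = 0) → v = 0) : b.IsInvertible := by
  have hinj : Function.Injective (b : E →ₗ[ℝ] E →L[ℝ] ℝ) := by
    rw [← LinearMap.ker_eq_bot, LinearMap.ker_eq_bot']
    intro v hv
    refine hb v fun w => ?_
    have : b v = 0 := hv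
    simp [this]
  have hrank : Module.finrank ℝ E = Module.finrank ℝ (E →L[ℝ] ℝ) := by
    have e : (E →L[ℝ] ℝ) ≃ₗ[ℝ] Module.Dual ℝ E := LinearMap.toContinuousLinearMap.symm
    rw [e.finrank_eq, Subspace.dual_finrank_eq]
  exact ⟨(LinearEquiv.ofInjectiveOfFinrankEq _ hinj hrank).toContinuousLinearEquiv, by ext; rfl⟩

lemma apply_sharp {b : E →L[ℝ] E →L[ℝ] ℝ} (hb : b.IsInvertible) (α : E →L[ℝ] ℝ) (w : E) :
    b (sharp b α) w = α w := by
  rw [sharp, hb.self_apply_inverse]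

lemma differentiableAt_clm_of_apply [FiniteDimensional ℝ E] {X : Type*} [NormedAddCommGroup X]
    [NormedSpace ℝ X] {A : X → E →L[ℝ] E'} {x : X}
    (h : ∀ v, DifferentiableAt ℝ (fun y => A y v) x) : DifferentiableAt ℝ A x := by
  let d := Module.finrank ℝ E
  let e₁ : E ≃L[ℝ] (Fin d → ℝ) := ContinuousLinearEquiv.ofFinrankEq (by simp [d])
  let e₂ : (E →L[ℝ] E') ≃L[ℝ] (Fin d → E') :=
    (e₁.arrowCongr (1 : E' ≃L[ℝ] E')).trans (ContinuousLinearEquiv.piRing (Fin d))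
  rw [← e₂.comp_differentiableAt_iff, differentiableAt_pi]
  exact fun i => h _

lemma differentiableAt_pullback [FiniteDimensional ℝ E] {X : Type*} [NormedAddCommGroup X]
    [NormedSpace ℝ X] {A : X → E →L[ℝ] E'} {b : X → E' →L[ℝ] E' →L[ℝ] ℝ} {x : X}
    (hA : DifferentiableAt ℝ A x) (hb : DifferentiableAt ℝ b x) :
    DifferentiableAt ℝ (fun y => pullback (A y) (b y)) x := by
  refine differentiableAt_clm_of_apply fun v => ?_
  exact (hb.clm_apply (hA.clm_apply (differentiableAt_const v))).clm_comp hA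

lemma apply_christoffel {G : E → E →L[ℝ] E →L[ℝ] ℝ} {y : E} (hG : (G y).IsInvertible)
    (u v w : E) : G y (christoffel G y u v) w =
      1 / 2 * (fderiv ℝ G y u v w + fderiv ℝ G y v u w - fderiv ℝ G y w u v) := by
  rw [christoffel, apply_sharp hG]
  simp

/-- The Koszul form of a pulled back metric, in terms of the Christoffel symbols of the
ambient metric. -/
lemma koszul_pullback [FiniteDimensional ℝ E] {P : E → E'} {y : E} (hP : ContDiffAt ℝ 2 P y)
    {G : E → E →L[ℝ] E →L[ℝ] ℝ} {G' : E' → E' →L[ℝ] E' →L[ℝ] ℝ}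
    (hd : DifferentiableAt ℝ G' (P y)) (hs : ∀ᶠ z in 𝓝 (P y), ∀ v w, G' z v w = G' z w v)
    (hi : (G' (P y)).IsInvertible)
    (hG : G =ᶠ[𝓝 y] fun z => pullback (fderiv ℝ P z) (G' (P z))) (u v w : E) :
    1 / 2 * (fderiv ℝ G y u v w + fderiv ℝ G y v u w - fderiv ℝ G y w u v) =
      G' (P y) (fderiv ℝ (fderiv ℝ P) y u v
        + christoffel G' (P y) (fderiv ℝ P y u) (fderiv ℝ P y v)) (fderiv ℝ P y w) := by
  have hP1 : DifferentiableAt ℝ P y := hP.differentiableAt (by norm_num)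
  have hP2 : DifferentiableAt ℝ (fderiv ℝ P) y :=
    (hP.fderiv_right (m := 1) (by norm_num)).differentiableAt (by norm_num)
  have hcomp : HasFDerivAt (fun z => G' (P z)) (fderiv ℝ G' (P y) ∘L fderiv ℝ P y) y :=
    HasFDerivAt.comp (G := E' →L[ℝ] E' →L[ℝ] ℝ) y hd.hasFDerivAt hP1.hasFDerivAt
  have hpd : DifferentiableAt ℝ (fun z => pullback (fderiv ℝ P z) (G' (P z))) y :=
    differentiableAt_pullback hP2 hcomp.differentiableAt
  -- Product rule for `G'(P)(∂_b P, ∂_c P)` in the direction `a`.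
  have key (a b c : E) : fderiv ℝ G y a b c =
      fderiv ℝ G' (P y) (fderiv ℝ P y a) (fderiv ℝ P y b) (fderiv ℝ P y c)
      + G' (P y) (fderiv ℝ (fderiv ℝ P) y a b) (fderiv ℝ P y c)
      + G' (P y) (fderiv ℝ P y b) (fderiv ℝ (fderiv ℝ P) y a c) := by
    rw [hG.fderiv_eq]
    have h1 := (hpd.hasFDerivAt.clm_apply (hasFDerivAt_const b y)).clm_apply
      (hasFDerivAt_const c y)
    have h2 := (hcomp.clm_apply (hP2.hasFDerivAt.clm_apply (hasFDerivAt_const b y))).clm_apply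
      (hP2.hasFDerivAt.clm_apply (hasFDerivAt_const c y))
    have h3 := congrArg (fun L => L a) (h1.unique h2)
    simp at h3
    linarith
  have hsymm (a b : E) : fderiv ℝ (fderiv ℝ P) y a b = fderiv ℝ (fderiv ℝ P) y b a :=
    (hP.isSymmSndFDerivAt (by simp)) a b
  have hs0 := hs.self_of_nhds
  -- In the Koszul combination the terms with `∂_u ∂_w P` and `∂_v ∂_w P` cancel by symmetry of `G'`
  -- and of second derivatives; the two with `∂_u ∂_v P` add up.
  rw [key, key, key, map_add, add_apply, apply_christoffel hi,
    hsymm v u, hsymm w u, hsymm w v, hs0 (fderiv ℝ P y v), hs0 (fderiv ℝ P y u)]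
  ring

end Linear

/-! ### Metrics read in charts -/

section Charts

variable {E H N : Type*} [NormedAddCommGroup E] [NormedSpace ℝ E] [TopologicalSpace H]
  {J : ModelWithCorners ℝ E H} [TopologicalSpace N] [ChartedSpace H N]

lemma hasMFDerivAt_extChartAt_symm [J.Boundaryless] [IsManifold J 1 N] (x₀ : N) {y : E}
    (hy : y ∈ (extChartAt J x₀).target) :
    HasMFDerivAt 𝓘(ℝ, E) J (extChartAt J x₀).symm y
      (mfderivWithin 𝓘(ℝ, E) J (extChartAt J x₀).symm (range J) y) := by
  have h := mdifferentiableWithinAt_extChartAt_symm hy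
  rw [J.range_eq_univ, mdifferentiableWithinAt_univ] at h
  rw [J.range_eq_univ, mfderivWithin_univ]
  exact h.hasMFDerivAt

lemma coordMetric_symm {g : MetricTensor J (N := N)} (hg : ∀ x v w, g x v w = g x w v) (x₀ : N)
    (y v w : E) : coordMetric g x₀ y v w = coordMetric g x₀ y w v :=
  hg _ _ _

/-- The tangent space at `x₀` is identified with `E` through the chart at `x₀` itself, so the
inverse chart has identity differential there. -/
lemma coordMetric_self [J.Boundaryless] [IsManifold J 1 N] (g : MetricTensor J (N := N))
    (x₀ : N) : coordMetric g x₀ (extChartAt J x₀ x₀) = formAt g x₀ := by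
  have h : mfderivWithin 𝓘(ℝ, E) J (extChartAt J x₀).symm (range J) (extChartAt J x₀ x₀) =
      ContinuousLinearMap.id ℝ E := by
    have := TangentBundle.symmL_trivializationAt (I := J) (mem_chart_source H x₀)
    rw [← this, TangentBundle.symmL_trivializationAt_eq_core (mem_chart_source H x₀)]
    ext v
    exact (tangentBundleCore J N).coordChange_self (achart H x₀) x₀ (mem_chart_source H x₀) v
  rw [coordMetric, h, extChartAt_to_inv]
  rfl

/-- Smoothness of `g` is a statement in the bundle trivialization at `x₀`, whose inverse on fibres
is the differential of the inverse chart; so the trivialized metric is `coordMetric` near the base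
point. -/
lemma differentiableAt_coordMetric [FiniteDimensional ℝ E] [J.Boundaryless] [IsManifold J 1 N]
    [IsManifold J ∞ N]
    (g : ContMDiffRiemannianMetric J ∞ E (fun x : N => TangentSpace J x)) (x₀ : N) :
    DifferentiableAt ℝ (coordMetric g.inner x₀) (extChartAt J x₀ x₀) := by
  have h := ((contMDiffAt_hom_bundle _).1 (g.contMDiff x₀)).2
  have hsymm : ContMDiffAt 𝓘(ℝ, E) J ∞ (extChartAt J x₀).symm (extChartAt J x₀ x₀) :=
    (contMDiffOn_extChartAt_symm x₀).contMDiffAt (extChartAt_target_mem_nhds x₀)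
  have hc := ContMDiffAt.comp_of_eq h hsymm (extChartAt_to_inv x₀)
  refine (hc.contDiffAt.differentiableAt (by simp)).congr_of_eventuallyEq ?_
  filter_upwards [extChartAt_target_mem_nhds (I := J) x₀] with y hy
  have hx : (extChartAt J x₀).symm y ∈ (chartAt H x₀).source := by
    rw [← extChartAt_source J x₀]
    exact (extChartAt J x₀).map_target hy
  have ht := TangentBundle.symmL_trivializationAt (I := J) hx
  rw [(extChartAt J x₀).right_inv hy] at ht
  ext v w
  rw [Function.comp_apply]
  erw [inCoordinates_apply_eq₂ (E₁ := TangentSpace J) (E₂ := TangentSpace J) (by simpa using hx)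
    (by simpa using hx) (mem_univ _)]
  rw [coordMetric, ← ht]
  refine Eq.trans ?_ (congrFun (Trivialization.coe_linearMapAt_of_mem (R := ℝ)
    (trivializationAt ℝ (Bundle.Trivial N ℝ) x₀) (mem_univ _)) _).symm
  have hv (v : E) := Trivialization.symmL_apply (R := ℝ)
    (trivializationAt E (TangentSpace J) x₀) (by simpa using hx) v
  exact congrArg₂ (fun a b : E => formAt g.inner ((extChartAt J x₀).symm y) a b) (hv v) (hv w)

variable {k : ℕ} {M : Type*} [TopologicalSpace M] [ChartedSpace (EuclideanSpace ℝ (Fin k)) M]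

/-- Chain rule applied to `ψ ∘ φ⁻¹ = χ⁻¹ ∘ P`, with `P` the chart expression of `ψ`. An identity
near the point is required, since Christoffel symbols differentiate it. -/
lemma coordMetric_inducedMetric [IsManifold (𝓡 k) 1 M] [J.Boundaryless] [IsManifold J 1 N] (g : MetricTensor J (N := N))
    {ψ : M → N} (hψ : MDifferentiable (𝓡 k) J ψ) (p : M) :
    coordMetric (inducedMetric k g ψ) p =ᶠ[𝓝 (extChartAt (𝓡 k) p p)]
      fun y => pullback (fderiv ℝ (writtenInExtChartAt (𝓡 k) J p ψ) y)
        (coordMetric g (ψ p) (writtenInExtChartAt (𝓡 k) J p ψ y)) := by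
  set φ := extChartAt (𝓡 k) p with hφ
  set χ := extChartAt J (ψ p) with hχ
  have hcont : ContinuousAt (ψ ∘ φ.symm) (φ p) := by
    refine ContinuousAt.comp_of_eq (hψ p).continuousAt (continuousAt_extChartAt_symm p) ?_
    exact extChartAt_to_inv p
  have hsrc : ∀ᶠ y in 𝓝 (φ p), ψ (φ.symm y) ∈ χ.source := by
    refine hcont.preimage_mem_nhds (extChartAt_source_mem_nhds' ?_)
    simp [hφ, mem_chart_source]
  filter_upwards [hsrc.eventually_nhds, extChartAt_target_mem_nhds (I := 𝓡 k) p] with y hy hyt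
  have hy0 : ψ (φ.symm y) ∈ χ.source := hy.self_of_nhds
  have hφy := hasMFDerivAt_extChartAt_symm (J := 𝓡 k) p hyt
  have hψy : HasMFDerivAt (𝓡 k) J ψ (φ.symm y) (mfderiv (𝓡 k) J ψ (φ.symm y)) :=
    (hψ _).hasMFDerivAt
  have hleft := hψy.comp y hφy
  have hχd : HasMFDerivAt J 𝓘(ℝ, E) χ (ψ (φ.symm y)) (mfderiv J 𝓘(ℝ, E) χ (ψ (φ.symm y))) :=
    (mdifferentiableAt_extChartAt (by rwa [← extChartAt_source J])).hasMFDerivAt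
  let D : EuclideanSpace ℝ (Fin k) →L[ℝ] E := fderiv ℝ (writtenInExtChartAt (𝓡 k) J p ψ) y
  have hw : HasMFDerivAt 𝓘(ℝ, EuclideanSpace ℝ (Fin k)) 𝓘(ℝ, E)
      (writtenInExtChartAt (𝓡 k) J p ψ) y D := by
    have h : MDifferentiableAt 𝓘(ℝ, EuclideanSpace ℝ (Fin k)) 𝓘(ℝ, E)
        (χ ∘ (ψ ∘ φ.symm)) y :=
      MDifferentiableAt.comp (I' := J) y hχd.mdifferentiableAt hleft.mdifferentiableAt
    rw [mdifferentiableAt_iff_differentiableAt] at h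
    exact h.hasFDerivAt.hasMFDerivAt
  have hχs := hasMFDerivAt_extChartAt_symm (J := J) (ψ p) (χ.map_source hy0)
  have hright := HasMFDerivAt.comp (g := χ.symm) y hχs hw
  have heq : ψ ∘ φ.symm =ᶠ[𝓝 y] χ.symm ∘ writtenInExtChartAt (𝓡 k) J p ψ := by
    filter_upwards [hy] with z hz
    exact (χ.left_inv hz).symm
  have hD := hasMFDerivAt_unique hleft (hright.congr_of_eventuallyEq heq)
  have hpt : χ.symm (writtenInExtChartAt (𝓡 k) J p ψ y) = ψ (φ.symm y) := χ.left_inv hy0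
  ext v w
  have hv := congrArg (fun L => L v) hD
  have hw' := congrArg (fun L => L w) hD
  change formAt g (ψ (φ.symm y)) _ _ = formAt g (χ.symm (writtenInExtChartAt (𝓡 k) J p ψ y)) _ _
  rw [hpt]
  exact congrArg₂ (fun a b : E => formAt g (ψ (φ.symm y)) a b) hv hw'

lemma diff_eq_fderiv [J.Boundaryless] {ψ : M → N} (hψ : MDifferentiable (𝓡 k) J ψ) (p : M) :
    diff k J ψ p = fderiv ℝ (writtenInExtChartAt (𝓡 k) J p ψ) (extChartAt (𝓡 k) p p) := by
  rw [diff, (hψ p).mfderiv, ModelWithCorners.range_eq_univ, fderivWithin_univ]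

end Charts

/-! ### The warped metric and its Christoffel symbols -/

section Spacetime

variable {m : ℕ} {F : Type*} [TopologicalSpace F] [ChartedSpace (EuclideanSpace ℝ (Fin m)) F]
  [IsManifold (𝓡 m) ∞ F]

lemma warpedMetric_apply (f : ℝ → ℝ) (gF : RiemMetric m F) (q : ℝ × F)
    (v w : ℝ × EuclideanSpace ℝ (Fin m)) :
    formAt (warpedMetric f gF) q v w = -(v.1 * w.1) + f q.1 ^ 2 * formAt gF.inner q.2 v.2 w.2 := by
  simp only [formAt, warpedMetric, mfderiv_fst, mfderiv_snd]
  rfl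

lemma coordMetric_warpedMetric (f : ℝ → ℝ) (gF : RiemMetric m F) (q : ℝ × F)
    {y : ℝ × EuclideanSpace ℝ (Fin m)} (hy : y.2 ∈ (extChartAt (𝓡 m) q.2).target) :
    coordMetric (warpedMetric f gF) q y =
      -pullback (ContinuousLinearMap.fst ℝ ℝ (EuclideanSpace ℝ (Fin m)))
          (ContinuousLinearMap.mul ℝ ℝ)
        + (f y.1 ^ 2) • pullback (ContinuousLinearMap.snd ℝ ℝ (EuclideanSpace ℝ (Fin m)))
          (coordMetric gF.inner q.2 y.2) := by
  have hs : (extChartAt (𝓘(ℝ, ℝ).prod (𝓡 m)) q).symm =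
      fun z : ℝ × EuclideanSpace ℝ (Fin m) => (z.1, (extChartAt (𝓡 m) q.2).symm z.2) := by
    rw [extChartAt_prod]
    rfl
  have h1 : HasMFDerivAt 𝓘(ℝ, ℝ × EuclideanSpace ℝ (Fin m)) 𝓘(ℝ, ℝ)
      (Prod.fst : ℝ × EuclideanSpace ℝ (Fin m) → ℝ) y
      (ContinuousLinearMap.fst ℝ ℝ (EuclideanSpace ℝ (Fin m))) :=
    hasFDerivAt_fst.hasMFDerivAt
  have h2 : HasMFDerivAt 𝓘(ℝ, ℝ × EuclideanSpace ℝ (Fin m)) 𝓘(ℝ, EuclideanSpace ℝ (Fin m))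
      (Prod.snd : ℝ × EuclideanSpace ℝ (Fin m) → EuclideanSpace ℝ (Fin m)) y
      (ContinuousLinearMap.snd ℝ ℝ (EuclideanSpace ℝ (Fin m))) :=
    hasFDerivAt_snd.hasMFDerivAt
  have h3 := (hasMFDerivAt_extChartAt_symm (J := 𝓡 m) q.2 hy).comp y h2
  have hD := (h1.prodMk h3).mfderiv
  refine ContinuousLinearMap.ext fun v => ContinuousLinearMap.ext fun w => ?_
  have hA (v : ℝ × EuclideanSpace ℝ (Fin m)) :
      mfderivWithin 𝓘(ℝ, ℝ × EuclideanSpace ℝ (Fin m)) (𝓘(ℝ, ℝ).prod (𝓡 m))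
        (extChartAt (𝓘(ℝ, ℝ).prod (𝓡 m)) q).symm (range (𝓘(ℝ, ℝ).prod (𝓡 m))) y v =
      (v.1, mfderivWithin 𝓘(ℝ, EuclideanSpace ℝ (Fin m)) (𝓡 m) (extChartAt (𝓡 m) q.2).symm
        (range (𝓡 m)) y.2 v.2) := by
    rw [ModelWithCorners.range_eq_univ, mfderivWithin_univ, hs]
    exact congrArg (fun L => L v) hD
  refine (congrArg₂ (fun a b : ℝ × EuclideanSpace ℝ (Fin m) =>
    formAt (warpedMetric f gF) ((extChartAt (𝓘(ℝ, ℝ).prod (𝓡 m)) q).symm y) a b)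
    (hA v) (hA w)).trans ?_
  simp only [hs]
  exact warpedMetric_apply f gF _ _ _

end Spacetime

section Spacetime

variable {m : ℕ} {F : Type*} [TopologicalSpace F] [ChartedSpace (EuclideanSpace ℝ (Fin m)) F]

lemma extChartAt_prod_apply (q x : ℝ × F) :
    extChartAt (𝓘(ℝ, ℝ).prod (𝓡 m)) q x = (x.1, extChartAt (𝓡 m) q.2 x.2) := by
  rw [extChartAt_prod]
  rfl

variable [IsManifold (𝓡 m) ∞ F]

lemma warpedMetric_comm (f : ℝ → ℝ) (gF : RiemMetric m F) (q : ℝ × F)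
    (v w : TangentSpace (𝓘(ℝ, ℝ).prod (𝓡 m)) q) :
    warpedMetric f gF q v w = warpedMetric f gF q w v := by
  have h := gF.symm q.2
  have h1 := warpedMetric_apply f gF q v w
  have h2 := warpedMetric_apply f gF q w v
  rw [formAt] at h1 h2
  refine h1.trans (Eq.trans ?_ h2.symm)
  rw [mul_comm]
  congr 2
  exact h _ _

lemma isInvertible_warpedMetric {f : ℝ → ℝ} (gF : RiemMetric m F) {q : ℝ × F} (hf : f q.1 ≠ 0) :
    (formAt (warpedMetric f gF) q).IsInvertible := by
  refine isInvertible_of_separatingLeft _ fun v hv => ?_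
  -- Reflecting the time component makes the pairing the positive definite `v.1² + f² g_F(v.2,
  -- v.2)`.
  have h := hv (-v.1, v.2)
  rw [warpedMetric_apply] at h
  have hpos : v.2 ≠ 0 → 0 < formAt gF.inner q.2 v.2 v.2 := gF.pos q.2 v.2
  have hf2 : 0 < f q.1 ^ 2 := by positivity
  have h2 : v.2 = 0 := by
    by_contra hne
    have := mul_pos hf2 (hpos hne)
    simp only at h
    nlinarith [mul_self_nonneg v.1]
  have h1 : v.1 = 0 := by
    simp only [h2, map_zero, mul_zero, add_zero] at h
    nlinarith
  exact Prod.ext h1 h2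

lemma coordMetric_warpedMetric_eventuallyEq (f : ℝ → ℝ) (gF : RiemMetric m F) (q : ℝ × F) :
    coordMetric (warpedMetric f gF) q =ᶠ[𝓝 (extChartAt (𝓘(ℝ, ℝ).prod (𝓡 m)) q q)] fun y =>
      -pullback (ContinuousLinearMap.fst ℝ ℝ (EuclideanSpace ℝ (Fin m)))
          (ContinuousLinearMap.mul ℝ ℝ)
        + (f y.1 ^ 2) • pullback (ContinuousLinearMap.snd ℝ ℝ (EuclideanSpace ℝ (Fin m)))
          (coordMetric gF.inner q.2 y.2) := by
  have h : ∀ᶠ y in 𝓝 (extChartAt (𝓘(ℝ, ℝ).prod (𝓡 m)) q q),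
      y.2 ∈ (extChartAt (𝓡 m) q.2).target := by
    rw [extChartAt_prod_apply]
    exact continuousAt_snd.preimage_mem_nhds (extChartAt_target_mem_nhds (I := 𝓡 m) q.2)
  filter_upwards [h] with y hy
  exact coordMetric_warpedMetric f gF q hy

lemma differentiableAt_coordMetric_warpedMetric {f : ℝ → ℝ} (gF : RiemMetric m F) {q : ℝ × F}
    (hf : DifferentiableAt ℝ f q.1) :
    DifferentiableAt ℝ (coordMetric (warpedMetric f gF) q)
      (extChartAt (𝓘(ℝ, ℝ).prod (𝓡 m)) q q) := by
  refine DifferentiableAt.congr_of_eventuallyEq ?_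
    (coordMetric_warpedMetric_eventuallyEq f gF q)
  rw [extChartAt_prod_apply]
  have hf' : DifferentiableAt ℝ (fun z : ℝ × EuclideanSpace ℝ (Fin m) => f z.1 ^ 2)
      (q.1, extChartAt (𝓡 m) q.2 q.2) := by
    have : DifferentiableAt ℝ f (q.1, extChartAt (𝓡 m) q.2 q.2).1 := hf
    exact (this.comp _ differentiableAt_fst).pow 2
  have hK : DifferentiableAt ℝ
      (fun z : ℝ × EuclideanSpace ℝ (Fin m) => coordMetric gF.inner q.2 z.2)
      (q.1, extChartAt (𝓡 m) q.2 q.2) := by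
    have hsnd : DifferentiableAt ℝ (Prod.snd : ℝ × EuclideanSpace ℝ (Fin m) → _)
        (q.1, extChartAt (𝓡 m) q.2 q.2) := differentiableAt_snd
    exact DifferentiableAt.comp
      (G := EuclideanSpace ℝ (Fin m) →L[ℝ] EuclideanSpace ℝ (Fin m) →L[ℝ] ℝ)
      (g := coordMetric gF.inner q.2) (q.1, extChartAt (𝓡 m) q.2 q.2)
      (differentiableAt_coordMetric gF q.2) hsnd
  refine differentiableAt_clm_of_apply fun v => differentiableAt_clm_of_apply fun w => ?_
  exact (hf'.mul ((hK.clm_apply (differentiableAt_const v.2)).clm_apply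
    (differentiableAt_const w.2))).const_add (-(v.1 * w.1))

/-- The time component of the Christoffel symbols of the warped metric. -/
lemma christoffelAt_warpedMetric_fst {f : ℝ → ℝ} (gF : RiemMetric m F) {q : ℝ × F}
    (hf : DifferentiableAt ℝ f q.1) (hf0 : f q.1 ≠ 0) (a b : ℝ × EuclideanSpace ℝ (Fin m)) :
    f q.1 * (christoffelAt (warpedMetric f gF) q a b).1 =
      deriv f q.1 * (formAt (warpedMetric f gF) q a b + a.1 * b.1) := by
  set G := coordMetric (warpedMetric f gF) q with hGdef
  set y := extChartAt (𝓘(ℝ, ℝ).prod (𝓡 m)) q q with hy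
  have hy1 : y.1 = q.1 := by rw [hy, extChartAt_prod_apply]
  have hy2 : y.2 = extChartAt (𝓡 m) q.2 q.2 := by rw [hy, extChartAt_prod_apply]
  have hGd : DifferentiableAt ℝ G y := differentiableAt_coordMetric_warpedMetric gF hf
  have hself : G y = formAt (warpedMetric f gF) q := coordMetric_self _ q
  have hev := coordMetric_warpedMetric_eventuallyEq f gF q
  have hi : (G y).IsInvertible := by rw [hself]; exact isInvertible_warpedMetric gF hf0
  have key (u v w : ℝ × EuclideanSpace ℝ (Fin m)) :
      fderiv ℝ G y u v w = fderiv ℝ (fun z => G z v w) y u := by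
    have h := (hGd.hasFDerivAt.clm_apply (hasFDerivAt_const v y)).clm_apply (hasFDerivAt_const w y)
    rw [h.fderiv]; simp
  have hscalar (v w : ℝ × EuclideanSpace ℝ (Fin m)) : (fun z => G z v w) =ᶠ[𝓝 y] fun z =>
      -(v.1 * w.1) + f z.1 ^ 2 * coordMetric gF.inner q.2 z.2 v.2 w.2 := by
    filter_upwards [hev] with z hz
    rw [hGdef, hz]
    rfl
  -- Pairing with `∂_t` sees only the constant coefficient `-dt²`.
  have h0 (u v : ℝ × EuclideanSpace ℝ (Fin m)) : fderiv ℝ G y u v (1, 0) = 0 := by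
    rw [key, (hscalar v (1, 0)).fderiv_eq]
    simp
  have h1 : fderiv ℝ G y (1, 0) a b =
      2 * f q.1 * deriv f q.1 * formAt gF.inner q.2 a.2 b.2 := by
    rw [key, (hscalar a b).fderiv_eq]
    have hf' : HasFDerivAt (fun z : ℝ × EuclideanSpace ℝ (Fin m) => f z.1)
        (deriv f q.1 • ContinuousLinearMap.fst ℝ ℝ (EuclideanSpace ℝ (Fin m))) y := by
      rw [← hy1] at hf ⊢
      exact hf.hasDerivAt.comp_hasFDerivAt y hasFDerivAt_fst
    have hK : DifferentiableAt ℝ (coordMetric gF.inner q.2) y.2 := by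
      rw [hy2]; exact differentiableAt_coordMetric gF q.2
    have hK' : HasFDerivAt (fun z => coordMetric gF.inner q.2 z a.2 b.2) _ y.2 :=
      (hK.hasFDerivAt.clm_apply (hasFDerivAt_const a.2 _)).clm_apply (hasFDerivAt_const b.2 _)
    have hK2 := hK'.comp y (hasFDerivAt_snd (𝕜 := ℝ) (E := ℝ))
    have hall := ((hf'.pow 2).mul hK2).const_add (-(a.1 * b.1))
    refine (congrArg (fun L => L (1, 0)) hall.fderiv).trans ?_
    have hs : coordMetric gF.inner q.2 y.2 = formAt gF.inner q.2 := by
      rw [hy2]; exact coordMetric_self _ q.2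
    simp [hs, hy1]
    ring
  -- Only `-½ ∂_t G(a, b) = -f f' g_F(a, b)` survives in the Koszul formula, and the left side is
  -- minus the time component of `Γ(a, b)`.
  have h := apply_christoffel hi a b (1, 0)
  rw [h0, h0, h1, hself, warpedMetric_apply] at h
  rw [warpedMetric_apply]
  change f q.1 * (christoffel G y a b).1 = _
  simp only [map_zero] at h
  linear_combination (-f q.1) * h

end Spacetime

/-! ### The Gauss formula -/

section Submanifold

variable {k : ℕ} {M : Type*} [TopologicalSpace M] [ChartedSpace (EuclideanSpace ℝ (Fin k)) M]
variable {E H N : Type*} [NormedAddCommGroup E] [NormedSpace ℝ E] [TopologicalSpace H]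
  {J : ModelWithCorners ℝ E H} [TopologicalSpace N] [ChartedSpace H N]

lemma contDiffAt_writtenInExtChartAt {ψ : M → N} (hψ : ContMDiff (𝓡 k) J ∞ ψ) (p : M) :
    ContDiffAt ℝ ∞ (writtenInExtChartAt (𝓡 k) J p ψ) (extChartAt (𝓡 k) p p) := by
  have h := (contMDiffAt_iff.1 (hψ p)).2
  rw [ModelWithCorners.range_eq_univ, contDiffWithinAt_univ] at h
  exact h

variable [IsManifold (𝓡 k) ∞ M] [IsManifold J ∞ N] [J.Boundaryless]

/-- The tangent part of the ambient derivative is the image of the intrinsic covariant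
derivative. -/
lemma tangentPart_ambientDeriv {g : MetricTensor J (N := N)} (hg : ∀ x v w, g x v w = g x w v)
    {ψ : M → N} (hψ : ContMDiff (𝓡 k) J ∞ ψ) (p : M)
    (hd : DifferentiableAt ℝ (coordMetric g (ψ p)) (extChartAt J (ψ p) (ψ p)))
    (hi : (formAt g (ψ p)).IsInvertible) (u v : EuclideanSpace ℝ (Fin k)) :
    tangentPart k g ψ p (ambientDeriv k g ψ p u v) =
      diff k J ψ p (christoffelAt (inducedMetric k g ψ) p u v) := by
  have hP := contDiffAt_writtenInExtChartAt hψ p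
  have hψd : MDifferentiable (𝓡 k) J ψ := hψ.mdifferentiable (by simp)
  have hpt : writtenInExtChartAt (𝓡 k) J p ψ (extChartAt (𝓡 k) p p) =
      extChartAt J (ψ p) (ψ p) := by
    simp only [writtenInExtChartAt, Function.comp_apply, extChartAt_to_inv]
  have hD := diff_eq_fderiv (k := k) hψd p
  rw [tangentPart, christoffelAt, christoffel, coordMetric_self]
  -- Both sides are `dψ` of the same `sharp`, so it suffices to compare the two covectors.
  congr 2
  ext w
  have hK := koszul_pullback (hP.of_le ENat.LEInfty.out) (G' := coordMetric g (ψ p))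
    (by rw [hpt]; exact hd) (Eventually.of_forall fun z v w => coordMetric_symm hg _ _ _ _)
    (by rw [hpt, coordMetric_self]; exact hi) (coordMetric_inducedMetric g hψd p) u v w
  rw [hpt, coordMetric_self, ← hD] at hK
  simp only [ContinuousLinearMap.coe_comp, Function.comp_apply, smul_apply, add_apply,
    sub_apply, ContinuousLinearMap.flip_apply, smul_eq_mul]
  exact hK.symm

lemma metricTrace_self {b : EuclideanSpace ℝ (Fin k) →L[ℝ] EuclideanSpace ℝ (Fin k) →L[ℝ] ℝ}
    (hs : ∀ v w, b v w = b w v) (hi : b.IsInvertible) :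
    metricTrace b (fun v w => b v w) = k := by
  simp [metricTrace, hs _ (sharp b _), apply_sharp hi]

end Submanifold

/-! ### Hessian and Laplacian of the time function -/

section Spacetime

variable {m k : ℕ} {F : Type*} [TopologicalSpace F] [ChartedSpace (EuclideanSpace ℝ (Fin m)) F]
  [IsManifold (𝓡 m) ∞ F] {M : Type*} [TopologicalSpace M]
  [ChartedSpace (EuclideanSpace ℝ (Fin k)) M]

lemma laplacian_neg (g : MetricTensor (𝓡 k) (N := M)) (u : M → ℝ) (p : M) :
    laplacian g (fun x => -u x) p = -laplacian g u p := by
  have h : (fun x => -u x) ∘ (extChartAt (𝓡 k) p).symm =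
      -(u ∘ (extChartAt (𝓡 k) p).symm) := rfl
  have hess (v w : EuclideanSpace ℝ (Fin k)) :
      hessian g (fun x => -u x) p v w = -hessian g u p v w := by
    have h1 : fderiv ℝ (-(u ∘ (extChartAt (𝓡 k) p).symm)) =
        -fderiv ℝ (u ∘ (extChartAt (𝓡 k) p).symm) := by
      funext z; exact fderiv_neg
    rw [hessian, hessian, h, h1, fderiv_neg]
    simp only [neg_apply, Pi.neg_apply]
    ring
  simp only [laplacian, metricTrace, hess, Finset.sum_neg_distrib]

variable [IsManifold (𝓡 k) ∞ M]

/-- The Hessian of `Φ(τ)`, where `Φ' = f` and `τ` is the time function of the submanifold. -/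
lemma hessian_comp_time {f Φ : ℝ → ℝ} {I : Set ℝ} (hI : IsOpen I) (hf : ContDiffOn ℝ ∞ f I)
    (hfpos : ∀ t ∈ I, 0 < f t) (hΦ : ∀ t ∈ I, HasDerivAt Φ (f t) t) (gF : RiemMetric m F)
    {ψ : M → ℝ × F} (hψ : ContMDiff (𝓡 k) (𝓘(ℝ, ℝ).prod (𝓡 m)) ∞ ψ) {p : M}
    (hp : (ψ p).1 ∈ I) (v w : EuclideanSpace ℝ (Fin k)) :
    hessian (inducedMetric k (warpedMetric f gF) ψ) (fun x => Φ (ψ x).1) p v w =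
      f (ψ p).1 * formAt (warpedMetric f gF) (ψ p)
        (secondFundamentalForm k (warpedMetric f gF) ψ p v w) (1, 0)
      - deriv f (ψ p).1 * formAt (inducedMetric k (warpedMetric f gF) ψ) p v w := by
  have hfd : DifferentiableAt ℝ f (ψ p).1 :=
    (hf.contDiffAt (hI.mem_nhds hp)).differentiableAt (by simp)
  have hf0 : f (ψ p).1 ≠ 0 := (hfpos _ hp).ne'
  have hψd : MDifferentiable (𝓡 k) (𝓘(ℝ, ℝ).prod (𝓡 m)) ψ := hψ.mdifferentiable (by simp)
  have hD := diff_eq_fderiv (k := k) hψd p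
  have hT := tangentPart_ambientDeriv (warpedMetric_comm f gF) hψ p
    (differentiableAt_coordMetric_warpedMetric gF hfd) (isInvertible_warpedMetric gF hf0) v w
  have hΓ := christoffelAt_warpedMetric_fst gF hfd hf0 (diff k (𝓘(ℝ, ℝ).prod (𝓡 m)) ψ p v)
    (diff k (𝓘(ℝ, ℝ).prod (𝓡 m)) ψ p w)
  set P := writtenInExtChartAt (𝓡 k) (𝓘(ℝ, ℝ).prod (𝓡 m)) p ψ with hPdef
  set y := extChartAt (𝓡 k) p p with hy
  have hP : ContDiffAt ℝ ∞ P y := contDiffAt_writtenInExtChartAt hψ p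
  have hcomp : (fun x => Φ (ψ x).1) ∘ (extChartAt (𝓡 k) p).symm = fun z => Φ (P z).1 := by
    funext z
    simp only [hPdef, writtenInExtChartAt, Function.comp_apply, extChartAt_prod_apply]
  have hPy : (P y).1 = (ψ p).1 := by
    simp only [hPdef, hy, writtenInExtChartAt, Function.comp_apply, extChartAt_prod_apply,
      extChartAt_to_inv]
  let fst' := ContinuousLinearMap.fst ℝ ℝ (EuclideanSpace ℝ (Fin m))
  have hfst (z : EuclideanSpace ℝ (Fin k)) (hz : DifferentiableAt ℝ P z) :
      HasFDerivAt (fun x => (P x).1) (fst' ∘L fderiv ℝ P z) z :=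
    (fst'.hasFDerivAt).comp z hz.hasFDerivAt
  have hPev : ∀ᶠ z in 𝓝 y, DifferentiableAt ℝ P z :=
    ((hP.of_le (m := 1) ENat.LEInfty.out).eventually (by simp)).mono
      fun z hz => hz.differentiableAt (by simp)
  have hIev : ∀ᶠ z in 𝓝 y, (P z).1 ∈ I := by
    refine (hfst y hPev.self_of_nhds).continuousAt.preimage_mem_nhds (hI.mem_nhds ?_)
    rwa [hPy]
  -- The first derivative is needed on a neighbourhood, as it is differentiated again.
  have hfirst : fderiv ℝ (fun z => Φ (P z).1) =ᶠ[𝓝 y]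
      fun z => f (P z).1 • (fst' ∘L fderiv ℝ P z) := by
    filter_upwards [hPev, hIev] with z hz hzI
    exact ((hΦ _ hzI).comp_hasFDerivAt z (hfst z hz)).fderiv
  have hP2 : DifferentiableAt ℝ (fderiv ℝ P) y :=
    (ContDiffAt.fderiv_right (m := 1) (n := 2) (hP.of_le ENat.LEInfty.out) (by norm_num)).differentiableAt (by simp)
  have hsecond : fderiv ℝ (fderiv ℝ (fun z => Φ (P z).1)) y v w =
      deriv f (ψ p).1 * (fderiv ℝ P y v).1 * (fderiv ℝ P y w).1
        + f (ψ p).1 * (fderiv ℝ (fderiv ℝ P) y v w).1 := by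
    rw [hfirst.fderiv_eq]
    have h1 : HasFDerivAt (fun z => f (P z).1) (deriv f (P y).1 • (fst' ∘L fderiv ℝ P y)) y := by
      rw [← hPy] at hfd
      exact hfd.hasDerivAt.comp_hasFDerivAt y (hfst y hPev.self_of_nhds)
    have h2 := (hasFDerivAt_const fst' y).clm_comp hP2.hasFDerivAt
    rw [HasFDerivAt.fderiv (f := fun z => f (P z).1 • (fst' ∘L fderiv ℝ P z)) (h1.smul h2)]
    simp [hPy, fst']
    ring
  have hfirst' (a : EuclideanSpace ℝ (Fin k)) : fderiv ℝ (fun z => Φ (P z).1) y a =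
      f (ψ p).1 * (fderiv ℝ P y a).1 := by
    rw [hfirst.self_of_nhds, ← hPy]
    rfl
  rw [hessian, hcomp, hsecond, hfirst', warpedMetric_apply, secondFundamentalForm, normalPart, hT,
    ambientDeriv]
  rw [hD] at hΓ ⊢
  have hind : formAt (inducedMetric k (warpedMetric f gF) ψ) p v w =
      formAt (warpedMetric f gF) (ψ p) (fderiv ℝ P y v) (fderiv ℝ P y w) := by
    rw [← hD]; rfl
  rw [hind]
  simp only [Prod.fst_neg, Prod.fst_sub, Prod.fst_add, map_zero, mul_zero, add_zero, mul_one]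
  -- The second derivatives of `P` and the intrinsic Christoffel terms agree on both sides; what
  -- remains is the warped Christoffel identity.
  linear_combination -hΓ

/-- The trace of `hessian_comp_time`: the second fundamental form contributes `k f ḡ(H, ∂_t)` and
the metric contributes `-k f'`. -/
lemma laplacian_comp_time {f Φ : ℝ → ℝ} {I : Set ℝ} (hI : IsOpen I) (hf : ContDiffOn ℝ ∞ f I)
    (hfpos : ∀ t ∈ I, 0 < f t) (hΦ : ∀ t ∈ I, HasDerivAt Φ (f t) t) (gF : RiemMetric m F)
    {ψ : M → ℝ × F} (hψ : ContMDiff (𝓡 k) (𝓘(ℝ, ℝ).prod (𝓡 m)) ∞ ψ)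
    (hspace : IsSpacelike k (warpedMetric f gF) ψ) {p : M} (hp : (ψ p).1 ∈ I) :
    laplacian (inducedMetric k (warpedMetric f gF) ψ) (fun x => Φ (ψ x).1) p =
      k * f (ψ p).1 * (warpedMetric f gF (ψ p) (meanCurvature k (warpedMetric f gF) ψ p)
        (partialT (ψ p)) - deriv f (ψ p).1 / f (ψ p).1) := by
  have hf0 : f (ψ p).1 ≠ 0 := (hfpos _ hp).ne'
  have hs : ∀ v w, formAt (inducedMetric k (warpedMetric f gF) ψ) p v w =
      formAt (inducedMetric k (warpedMetric f gF) ψ) p w v :=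
    fun v w => warpedMetric_comm f gF _ _ _
  have hi : (formAt (inducedMetric k (warpedMetric f gF) ψ) p).IsInvertible := by
    refine isInvertible_of_separatingLeft _ fun v hv => ?_
    by_contra hne
    exact (hspace p v hne).ne' (hv v)
  have htr := metricTrace_self hs hi
  have hH : warpedMetric f gF (ψ p) (meanCurvature k (warpedMetric f gF) ψ p) (partialT (ψ p)) =
      (1 / k : ℝ) * metricTrace (formAt (inducedMetric k (warpedMetric f gF) ψ) p)
        (fun v w => formAt (warpedMetric f gF) (ψ p)
          (secondFundamentalForm k (warpedMetric f gF) ψ p v w) (1, 0)) := by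
    change formAt (warpedMetric f gF) (ψ p) ((1 / k : ℝ) • metricTrace _ _) (1, 0) = _
    simp [metricTrace]
  rw [hH, laplacian, metricTrace]
  simp only [hessian_comp_time hI hf hfpos hΦ gF hψ hp, Finset.sum_sub_distrib, ← Finset.mul_sum]
  rw [metricTrace] at htr
  rw [htr, metricTrace]
  -- For `k = 0` the traces are empty sums and both sides vanish; otherwise the factor `1 / k` in
  -- `H` cancels.
  rcases Nat.eq_zero_or_pos k with rfl | hk
  · simp
  · have : (k : ℝ) ≠ 0 := by positivity
    field_simp

/-- A smooth primitive of a smooth positive function on an open interval. -/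
lemma exists_primitive {f : ℝ → ℝ} {I : Set ℝ} (hI : IsOpen I) (hI' : I.OrdConnected)
    (hf : ContDiffOn ℝ ∞ f I) (hfpos : ∀ t ∈ I, 0 < f t) {c : ℝ} (hc : c ∈ I) :
    ∃ Φ : ℝ → ℝ, (∀ t ∈ I, HasDerivAt Φ (f t) t) ∧ ContDiffOn ℝ ∞ Φ I ∧ StrictMonoOn Φ I := by
  have hΦ : ∀ t ∈ I, HasDerivAt (fun t => ∫ s in c..t, f s) (f t) t := by
    intro t ht
    refine intervalIntegral.integral_hasDerivAt_right ?_ ?_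
      (hf.continuousOn.continuousAt (hI.mem_nhds ht))
    -- Order-connectedness of `I` keeps the interval from `c` to `t` inside the domain where `f` is
    -- known to be continuous.
    · exact (hf.continuousOn.mono (hI'.uIcc_subset hc ht)).intervalIntegrable
    · exact hf.continuousOn.stronglyMeasurableAtFilter hI t ht
  refine ⟨_, hΦ, ?_, ?_⟩
  · rw [contDiffOn_infty_iff_deriv_of_isOpen hI]
    exact ⟨fun t ht => (hΦ t ht).differentiableAt.differentiableWithinAt,
      hf.congr fun t ht => (hΦ t ht).deriv⟩
  · refine strictMonoOn_of_deriv_pos hI'.convex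
      (fun t ht => (hΦ t ht).continuousAt.continuousWithinAt) fun t ht => ?_
    rw [(hΦ t (interior_subset ht)).deriv]
    exact hfpos t (interior_subset ht)

end Spacetime

end GRW

/-! ### The main theorem -/

open Set in
open scoped Manifold ContDiff in
/-- Parabolic spacelike submanifolds `ψ(M)` of a GRW spacetime `I ×_f F` that lie in a slab and
satisfy one of the two mean curvature bounds are contained in a spacelike slice. -/
theorem theorem4p8 {m k : ℕ} (hm : 2 ≤ m)
    {F : Type*} [TopologicalSpace F] [ChartedSpace (EuclideanSpace ℝ (Fin m)) F]
    [IsManifold (𝓡 m) ∞ F] [ConnectedSpace F] (gF : GRW.RiemMetric m F)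
    (I : Set ℝ) (hI : IsOpen I) (hI' : I.OrdConnected)
    (f : ℝ → ℝ) (hf : ContDiffOn ℝ ∞ f I) (hfpos : ∀ t ∈ I, 0 < f t)
    {M : Type*} [TopologicalSpace M] [ChartedSpace (EuclideanSpace ℝ (Fin k)) M]
    [IsManifold (𝓡 k) ∞ M] [ConnectedSpace M]
    (ψ : M → ℝ × F) (hψ : ContMDiff (𝓡 k) (𝓘(ℝ, ℝ).prod (𝓡 m)) ∞ ψ)
    (hψI : ∀ p, (ψ p).1 ∈ I)
    (hspace : GRW.IsSpacelike k (GRW.warpedMetric f gF) ψ)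
    (hpar : GRW.IsParabolic (GRW.inducedMetric k (GRW.warpedMetric f gF) ψ))
    (hslab : GRW.InSlab I (range ψ))
    (hH :
      (∀ p, GRW.warpedMetric f gF (ψ p) (GRW.meanCurvature k (GRW.warpedMetric f gF) ψ p)
          (GRW.partialT (ψ p)) ≤ deriv f (ψ p).1 / f (ψ p).1) ∨
      (∀ p, deriv f (ψ p).1 / f (ψ p).1 ≤
        GRW.warpedMetric f gF (ψ p) (GRW.meanCurvature k (GRW.warpedMetric f gF) ψ p)
          (GRW.partialT (ψ p)))) :
    ∃ t₀ ∈ I, range ψ ⊆ GRW.slice F t₀ := by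
  obtain ⟨c, hc, d, hd, hcd⟩ := hslab
  have hτ (p : M) : (ψ p).1 ∈ Icc c d := (hcd (mem_range_self p)).1
  obtain ⟨Φ, hΦ, hΦs, hΦm⟩ := GRW.exists_primitive hI hI' hf hfpos hc
  have hu : ContMDiff (𝓡 k) 𝓘(ℝ, ℝ) ∞ (fun x => Φ (ψ x).1) := by
    intro p
    have h1 : ContMDiffAt 𝓘(ℝ, ℝ) 𝓘(ℝ, ℝ) ∞ Φ (ψ p).1 :=
      (hΦs.contDiffAt (hI.mem_nhds (hψI p))).contMDiffAt
    exact h1.comp p (contMDiff_fst.comp hψ p)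
  have hlap (p : M) := GRW.laplacian_comp_time hI hf hfpos hΦ gF hψ hspace (hψI p)
  have hkf (p : M) : 0 ≤ (k : ℝ) * f (ψ p).1 :=
    mul_nonneg (Nat.cast_nonneg k) (hfpos _ (hψI p)).le
  have hconst : ∃ a : ℝ, ∀ p, Φ (ψ p).1 = a := by
    -- The upper bound makes `u` superharmonic, with `u ≥ Φ c`; the lower bound does so for `-u`,
    -- with `-u ≥ -Φ d`.
    rcases hH with hH | hH
    · refine hpar _ hu (fun p => ?_) ⟨Φ c, ?_⟩
      · rw [hlap]
        exact mul_nonpos_of_nonneg_of_nonpos (hkf p) (sub_nonpos.2 (hH p))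
      · rintro _ ⟨p, rfl⟩
        exact hΦm.monotoneOn hc (hψI p) (hτ p).1
    · have hsuper (p : M) : GRW.laplacian (GRW.inducedMetric k (GRW.warpedMetric f gF) ψ)
          (fun x => -Φ (ψ x).1) p ≤ 0 := by
        rw [GRW.laplacian_neg, hlap]
        exact neg_nonpos.2 (mul_nonneg (hkf p) (sub_nonneg.2 (hH p)))
      have hbdd : BddBelow (range fun x => -Φ (ψ x).1) := by
        refine ⟨-Φ d, ?_⟩
        rintro _ ⟨p, rfl⟩
        exact neg_le_neg (hΦm.monotoneOn (hψI p) hd (hτ p).2)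
      obtain ⟨a, ha⟩ := hpar _ hu.neg hsuper hbdd
      exact ⟨-a, fun p => by rw [← ha p, neg_neg]⟩
  obtain ⟨a, ha⟩ := hconst
  obtain ⟨p₀⟩ : Nonempty M := inferInstance
  refine ⟨(ψ p₀).1, hψI p₀, ?_⟩
  rintro _ ⟨p, rfl⟩
  exact ⟨hΦm.injOn (hψI p) (hψI p₀) ((ha p).trans (ha p₀).symm), mem_univ _⟩
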